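/- Let $\Delta t>0$ and consider $m$ agents with model $\sum_{n\ge 0} a_{n,i}\,\frac{d^n x_i}{dt^n}=\sum_{j\ne i} b_{ij}x_j+p_i$, $a_{n,i},b_{ij}\in\mathbb{C}$, where each characteristic polynomial $a_i(s)=\sum_n a_{n,i}s^n$ has degree at least one and all its roots in $\{\operatorname{Re} s<0\}$. Discretize by the bilinear transform: $S_i(z)=a_i\!\big(\tfrac{2(1-z^{-1})}{\Delta t(1+z^{-1})}\big)$, $\mathsf h_{ij}(z)=b_{ij}/S_i(z)$ for $i\neq j$, $\mathsf h_{ii}=0$, and $$x_i(k)=\sum_{j}(h_{ij}*x_j)(k)+e_i(k),\qquad \mathsf e_i(z)=\mathsf p_i(z)/S_i(z),\qquad k\in\mathbb Z,$$ where impulse responses are the inverse $z$-transforms on the unit circle and all series converge in $L^2$. The inputs $p_1,\dots,p_m$ are complex square-integrable, zero-mean, mutually uncorrelated, wide-sense cyclostationary processes (with respect to the mean and $\mathbb{E}[p_i(s)\overline{p_i(t)}]$) of (minimal) periods $T_1,\dots,T_m$; let $T=\mathrm{lcm}(T_1,\dots,T_m)$. For a scalar process $y$ let $Y(k)=[y(kT),\dots,y(kT+T-1)]'$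 be its lift, let $X$ be the stacked lift of $x_1,\dots,x_m$, and let $\Phi_Y(\omega)=\sum_{\tau}\mathbb{E}[Y(\tau)Y(0)^*]e^{-\iota\omega\tau}$ denote power spectral densities, the correlations being absolutely summable. Assume topological detectability: for every $i$, $\Phi_{E_i}$ exists and $\Phi_{E_i}(\omega)\succ0$ for almost every $\omega\in[0,2\pi)$. In the linear dynamic graph there is an edge from $j$ to $i$ (so $i$ is a child of $j$) iff $\mathsf h_{ij}\ne0$; the topology is the underlying undirected graph. Assume any two distinct nodes have at most one common child, and let $i$ and $j$ be neighbours in the topology. Keep all data except $(b_{ij},b_{ji})$ fixed, and let $\mathcal N\subset\mathbb{C}^2$ be the set of pairs $(b_{ij},b_{ji})$ for which the model has an output $x$ (a solution of the equations above that is jointly wide-sense cyclostationary of period $T$, with $\Phi_X$ existing) such that the eigenvalues $\mathcal E_{ji}(1),\dots,\mathcal E_{ji}(T)$ of the $(j,i)$ block $\boldsymbol B_j'\Phi_X^{-1}(\omega)\boldsymbol B_i$, suitably numbered at each $\omega$, have phases that do not depend on $\omega$, as $\omega$ ranges over the points of $[0,2\pi)$ where $\Phi_X(\omega)$ is invertible: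 there are constants $c_1,\dots,c_T$ with $\arg\mathcal E_{ji}(l)=c_l$ whenever $\mathcal E_{ji}(l)\neq0$. Then $\mathcal N$ has Lebesgue measure zero in $\mathbb{C}^2$. Moreover, if only one of the two edges is present, the same holds for its weight alone: if $b_{ji}=0$ in the given model, then $\{\beta\in\mathbb{C}:(\beta,0)\in\mathcal N\}$ has measure zero in $\mathbb{C}$, and if $b_{ij}=0$, then $\{\gamma\in\mathbb{C}:(0,\gamma)\in\mathcal N\}$ has measure zero in $\mathbb{C}$. -/

import Mathlib

open MeasureTheory Complex
open scoped ComplexOrder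

noncomputable section

/-! ### Second-order processes -/

/-- A discrete-time process of complex, square-integrable random variables. -/
abbrev L2Seq {Ω : Type*} [MeasurableSpace Ω] (P : Measure Ω) : Type _ :=
  ℤ → Lp ℂ 2 P

section

variable {Ω : Type*} [MeasurableSpace Ω] {P : Measure Ω}

/-- The mean `E[x(t)]`. -/
def procMean (x : L2Seq P) (t : ℤ) : ℂ :=
  ∫ w, (x t : Ω → ℂ) w ∂P

/-- The (cross-)correlation `E[x(s) conj(y(t))]`. -/
def corr (x y : L2Seq P) (s t : ℤ) : ℂ :=
  ∫ w, (x s : Ω → ℂ) w * (starRingEnd ℂ) ((y t : Ω → ℂ) w) ∂P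

/-- `x` is wide-sense cyclostationary of period `n`: `n` is the smallest positive integer such that
the mean and the correlation are invariant under a time shift by `n`. -/
def IsWSCS (x : L2Seq P) (n : ℕ) : Prop :=
  IsLeast {d : ℕ | 0 < d ∧ (∀ t, procMean x (t + d) = procMean x t) ∧
    ∀ s t, corr x x (s + d) (t + d) = corr x x s t} n

/-- The means and all cross-correlations of the family `x` are invariant under a time shift
by `T`. -/
def IsJointlyCyclostationary {κ : Type*} (x : κ → L2Seq P) (T : ℕ) : Prop :=
  (∀ i t, procMean (x i) (t + T) = procMean (x i) t) ∧
    ∀ i j s t, corr (x i) (x j) (s + T) (t + T) = corr (x i) (x j) s t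

/-- `y = h * x`, the series converging in `L²` at every time. -/
def IsFiltered (h : ℤ → ℂ) (x y : L2Seq P) : Prop :=
  ∀ k, HasSum (fun n : ℤ => h n • x (k - n)) (y k)

/-- The lift of a scalar process to the `T`-dimensional process
`X(k) = [x(kT), …, x(kT+T-1)]'`; the `p`-th component is given. -/
def liftSeq (T : ℕ) (x : L2Seq P) (p : Fin T) : L2Seq P :=
  fun k => x (k * (T : ℤ) + ((p : ℕ) : ℤ))

/-- The lift of a family of `m` scalar processes to the stacked `mT`-dimensional process. -/
def liftFamily {m : ℕ} (T : ℕ) (x : Fin m → L2Seq P) (a : Fin m × Fin T) : L2Seq P :=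
  liftSeq T (x a.1) a.2

/-- Absolute summability of the correlations, so that the power spectral density of the
(stationary) vector process `Y` exists as a function of the frequency. -/
def HasPSD {κ : Type*} (Y : κ → L2Seq P) : Prop :=
  ∀ a b, Summable fun τ : ℤ => corr (Y a) (Y b) τ 0

/-- The power spectral density `Φ_Y(ω) = ∑_τ E[Y(τ) Y(0)^*] e^{-iωτ}` of a wide-sense stationary
vector process `Y`. -/
def psd {κ : Type*} (Y : κ → L2Seq P) (ω : ℝ) : Matrix κ κ ℂ :=
  Matrix.of fun a b => ∑' τ : ℤ, corr (Y a) (Y b) τ 0 * exp (-(I * ω * τ))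

end

/-- The `(j, i)` block, of size `T × T`, of an `mT × mT` matrix. -/
def block {m T : ℕ} (A : Matrix (Fin m × Fin T) (Fin m × Fin T) ℂ) (j i : Fin m) :
    Matrix (Fin T) (Fin T) ℂ :=
  Matrix.of fun p q => A (j, p) (i, q)

/-! ### Linear dynamical models -/

/-- The parameters of the networked model
`∑ₙ a_{n,i} dⁿxᵢ/dtⁿ = ∑_{j ≠ i} b_{ij} xⱼ + pᵢ`, sampled with period `dt`.
The coefficients `a_{n,i}` are those of the polynomial `a i`; the diagonal of `b` is not used. -/
structure LDM (m : ℕ) where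
  dt : ℝ
  a : Fin m → Polynomial ℂ
  b : Fin m → Fin m → ℂ

namespace LDM

variable {m : ℕ}

/-- `Sᵢ(z) = ∑ₙ a_{n,i} (2 (1 - z⁻¹) / (Δt (1 + z⁻¹)))ⁿ`, obtained by the bilinear transform. (The
value at the single point `z = -1` of the unit circle, where the fraction has a pole, is never
relevant: only integrals over the circle are used.) -/
def S (L : LDM m) (i : Fin m) (z : ℂ) : ℂ :=
  (L.a i).eval (2 * (1 - z⁻¹) / (L.dt * (1 + z⁻¹)))

/-- The transfer function `h_{ij}(z) = b_{ij} / Sᵢ(z)` for `i ≠ j`, and `h_{ii} = 0`. -/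
def transfer (L : LDM m) (i j : Fin m) (z : ℂ) : ℂ :=
  if i = j then 0 else L.b i j / L.S i z

/-- The inverse `z`-transform on the unit circle: the sequence `f` with
`F(z) = ∑ₙ f(n) z⁻ⁿ` for `|z| = 1`. -/
def invZ (F : ℂ → ℂ) (n : ℤ) : ℂ :=
  (2 * Real.pi : ℂ)⁻¹ * ∫ ω in (0 : ℝ)..(2 * Real.pi), F (exp (I * ω)) * exp (I * ω * n)

/-- The node dynamics are genuine (of order at least one) and stable: the characteristic roots lie
in the open left half plane, equivalently `1 / Sᵢ(z)` has all its poles in the open unit disc. -/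
def IsStable (L : LDM m) : Prop :=
  0 < L.dt ∧ ∀ i, 0 < (L.a i).natDegree ∧ ∀ s : ℂ, (L.a i).IsRoot s → s.re < 0

/-- `(i, j)` is an edge of the linear dynamic graph (directed from `j` to `i`): `h_{ij} ≠ 0`. -/
def Edge (L : LDM m) (i j : Fin m) : Prop :=
  L.transfer i j ≠ 0

/-- The topology: the undirected graph underlying the linear dynamic graph. -/
def topology (L : LDM m) : SimpleGraph (Fin m) :=
  SimpleGraph.fromRel L.Edge

/-- Any two distinct nodes have at most one common child. -/
def AtMostOneCommonChild (L : LDM m) : Prop :=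
  ∀ i j, i ≠ j → {k | L.Edge k i ∧ L.Edge k j}.ncard ≤ 1

/-- The same model with the two weights `b_{ij}`, `b_{ji}` replaced by `β`, `γ`. -/
def withWeights (L : LDM m) (i j : Fin m) (β γ : ℂ) : LDM m where
  dt := L.dt
  a := L.a
  b := fun r s => if r = i ∧ s = j then β else if r = j ∧ s = i then γ else L.b r s

variable {Ω : Type*} [MeasurableSpace Ω] {P : Measure Ω}

/-- The processes `p` are admissible exogenous inputs with periods `per`, and `e` are the processes
`eᵢ(z) = pᵢ(z) / Sᵢ(z)` that drive the discrete-time model. -/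
structure IsInput (L : LDM m) (per : Fin m → ℕ) (p e : Fin m → L2Seq P) : Prop where
  zero_mean : ∀ i t, procMean (p i) t = 0
  wscs : ∀ i, IsWSCS (p i) (per i)
  uncorrelated : ∀ i j, i ≠ j → ∀ s t, corr (p i) (p j) s t = 0
  filtered : ∀ i, IsFiltered (invZ fun z => 1 / L.S i z) (p i) (e i)

/-- `x` is an output of the model driven by `e`: it satisfies
`xᵢ(k) = ∑_{j ≠ i} (h_{ij} * xⱼ)(k) + eᵢ(k)`, it is jointly cyclostationary of period `T`, and the
lifted process has a power spectral density. -/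
structure IsOutput (L : LDM m) (T : ℕ) (e x : Fin m → L2Seq P) : Prop where
  dynamics : ∀ i k,
    HasSum (fun n : ℤ => ∑ j, invZ (L.transfer i j) n • x j (k - n)) (x i k - e i k)
  cyclostationary : IsJointlyCyclostationary x T
  hasPSD : HasPSD (liftFamily T x)

end LDM

/-- Topological detectability: for every `i` the lifted process `Eᵢ` has a power spectral density
which is positive definite at almost all frequencies. -/
def TopologicallyDetectable {Ω : Type*} [MeasurableSpace Ω] {P : Measure Ω} {m : ℕ} (T : ℕ)
    (e : Fin m → L2Seq P) : Prop :=
  ∀ i, HasPSD (liftSeq T (e i)) ∧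
    ∀ᵐ ω ∂(volume.restrict (Set.Ico (0 : ℝ) (2 * Real.pi))), (psd (liftSeq T (e i)) ω).PosDef

/-- The eigenvalues of `M ω`, listed with multiplicity as `ev ω 1, …, ev ω T` in some order, have
phases that do not depend on the frequency `ω ∈ F` (the phase of a zero eigenvalue is undefined and
nothing is required of it). -/
def HasConstantPhases {T : ℕ} (F : Set ℝ) (M : ℝ → Matrix (Fin T) (Fin T) ℂ) : Prop :=
  ∃ (ev : ℝ → Fin T → ℂ) (c : Fin T → ℝ), ∀ ω ∈ F,
    (M ω).charpoly.roots = Finset.univ.val.map (ev ω) ∧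
      ∀ l, ev ω l ≠ 0 → (ev ω l).arg = c l

/-- The frequencies in `[0, 2π)` at which `Φ_X(ω)` is invertible. -/
def regularFrequencies {Ω : Type*} [MeasurableSpace Ω] {P : Measure Ω} {m : ℕ} (T : ℕ)
    (x : Fin m → L2Seq P) : Set ℝ :=
  {ω ∈ Set.Ico (0 : ℝ) (2 * Real.pi) | IsUnit (psd (liftFamily T x) ω)}

/-- The pairs `(b_{ij}, b_{ji})` for which the model, all other data being kept fixed, has an output
`x` such that the phases of the eigenvalues of the `(j, i)` block of `Φ_X(ω)⁻¹` are constant. -/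
def constantPhaseWeights {Ω : Type*} [MeasurableSpace Ω] {P : Measure Ω} {m : ℕ} (L : LDM m)
    (T : ℕ) (e : Fin m → L2Seq P) (i j : Fin m) : Set (ℂ × ℂ) :=
  {q | ∃ x : Fin m → L2Seq P, (L.withWeights i j q.1 q.2).IsOutput T e x ∧
    HasConstantPhases (regularFrequencies T x)
      fun ω => block (psd (liftFamily T x) ω)⁻¹ j i}

end

/-! Lifting turns the model into `X = H * X + E` with `E` stationary, so `Φ_E = (1 - H) Φ_X (1 -
H)^*` (`psd_factorization`). The inputs are uncorrelated, hence `Φ_E` is block diagonal, and `Φ_X⁻¹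
= (1 - H)^* Φ_E⁻¹ (1 - H)` wherever all `Φ_{E_k}` are positive definite. With `G_k` the lift of `1 /
S_k`, the `(j, i)` block is `C - conj β • G_i^* Φ_{E_i}⁻¹ - γ • Φ_{E_j}⁻¹ G_j`, where `C` does not
involve the weights `β = b_{ij}`, `γ = b_{ji}` (`LDM.weightedBlock`).

If the eigenvalue phases are constant, so is the phase of their product: `det M(ω) * conj (det
M(ω'))` is real for all regular `ω`, `ω'`. For a fixed pair of frequencies and one fixed weight,
this is a real polynomial equation in the real and imaginary parts of the other weight. Its top
coefficient is a positive multiple of `det G(ω) * conj (det G(ω'))`, or of the conjugate, so the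
equation is nontrivial as soon as this number is not real; Fubini then gives a null set.

Such a pair exists by complex analysis (`exists_det_lift_phase_ne`). As a function of `w = e^{-iω}`,
`det G` is analytic in the disc and continuous up to the circle, and it is nonzero at `0`. Since the
characteristic polynomial has positive degree, the bilinear transform puts a zero of `1 / S` at `z =
-1`, so `det G` vanishes somewhere on the circle. A function with these properties cannot have
constant phase modulo `π` on the circle. -/

/-! ### Fourier series of convolutions -/

/-- The character `e^{-iωτ}` of `ℤ`. -/
noncomputable def fchar (ω : ℝ) (τ : ℤ) : ℂ := exp (-(I * ω * τ))

lemma fchar_add (ω : ℝ) (s t : ℤ) : fchar ω (s + t) = fchar ω s * fchar ω t := by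
  simp only [fchar, ← Complex.exp_add]
  push_cast
  ring_nf

lemma norm_fchar (ω : ℝ) (τ : ℤ) : ‖fchar ω τ‖ = 1 := by
  simp [fchar, Complex.norm_exp]

lemma star_fchar (ω : ℝ) (τ : ℤ) : (starRingEnd ℂ) (fchar ω τ) = fchar ω (-τ) := by
  simp [fchar, ← Complex.exp_conj]

lemma summable_mul_fchar {f : ℤ → ℂ} (ω : ℝ) :
    Summable (fun τ => f τ * fchar ω τ) ↔ Summable f := by
  rw [← summable_norm_iff, ← summable_norm_iff (f := f)]
  simp [norm_fchar]

lemma hasSum_conv {f g : ℤ → ℂ} (hf : Summable f) (hg : Summable g) :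
    HasSum (fun τ => ∑' ν, f ν * g (τ - ν)) ((∑' ν, f ν) * ∑' ν, g ν) := by
  have h := (summable_mul_of_summable_norm hf.norm hg.norm).hasSum
  rw [← tsum_mul_tsum_of_summable_norm hf.norm hg.norm] at h
  -- The reindexing `(τ, ν) ↦ (ν, τ - ν)` turns the double series of the product into a sum over `τ`
  -- of convolution values.
  let eqv : ℤ × ℤ ≃ ℤ × ℤ :=
    { toFun := fun x => (x.2, x.1 - x.2)
      invFun := fun x => (x.1 + x.2, x.1)
      left_inv := fun x => by simp
      right_inv := fun x => by simp }
  have h2 := (eqv.hasSum_iff).2 h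
  have h3 : Summable (fun x : ℤ × ℤ => f x.2 * g (x.1 - x.2)) := h2.summable
  exact h2.prod_fiberwise fun τ => (h3.prod_factor τ).hasSum

lemma hasSum_conv_mul_fchar {f g : ℤ → ℂ} (hf : Summable f) (hg : Summable g) (ω : ℝ) :
    HasSum (fun τ => (∑' ν, f ν * g (τ - ν)) * fchar ω τ)
      ((∑' ν, f ν * fchar ω ν) * ∑' ν, g ν * fchar ω ν) := by
  convert hasSum_conv ((summable_mul_fchar ω).2 hf) ((summable_mul_fchar ω).2 hg) using 2 with τ
  rw [← tsum_mul_right]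
  congr 1 with ν
  rw [show fchar ω τ = fchar ω ν * fchar ω (τ - ν) by rw [← fchar_add]; congr 1; ring]
  ring

section

variable {Ω : Type*} [MeasurableSpace Ω] {P : Measure Ω}

/-! ### Cross spectra -/

lemma corr_eq_inner (x y : L2Seq P) (s t : ℤ) : corr x y s t = inner ℂ (y t) (x s) := by
  simp [corr, L2.inner_def]

lemma conj_corr (x y : L2Seq P) (s t : ℤ) :
    (starRingEnd ℂ) (corr x y s t) = corr y x t s := by
  simp only [corr_eq_inner, inner_conj_symm]

variable {κ κ' κ'' : Type*}

/-- Summability of the cross-correlations. -/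
def HasCrossSpectrum (Y : κ → L2Seq P) (Z : κ' → L2Seq P) : Prop :=
  ∀ a b, Summable fun τ : ℤ => corr (Y a) (Z b) τ 0

/-- The cross spectral density of two vector processes. -/
noncomputable def crossSpectrum (Y : κ → L2Seq P) (Z : κ' → L2Seq P) (ω : ℝ) : Matrix κ κ' ℂ :=
  Matrix.of fun a b => ∑' τ : ℤ, corr (Y a) (Z b) τ 0 * fchar ω τ

/-- The cross-correlations depend on the time difference only. -/
def JointlyStationary (Y : κ → L2Seq P) (Z : κ' → L2Seq P) : Prop :=
  ∀ a b s t, corr (Y a) (Z b) (s + 1) (t + 1) = corr (Y a) (Z b) s t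

/-- The transfer matrix of a matrix-valued impulse response. -/
noncomputable def transferMatrix (H : ℤ → Matrix κ κ' ℂ) (ω : ℝ) : Matrix κ κ' ℂ :=
  Matrix.of fun a b => ∑' ν : ℤ, H ν a b * fchar ω ν

/-- The vector process `Y` is the convolution of the matrix-valued impulse response `H` with the
vector process `X`. -/
def IsMatrixFiltered [Fintype κ'] (H : ℤ → Matrix κ κ' ℂ) (X : κ' → L2Seq P)
    (Y : κ → L2Seq P) : Prop :=
  ∀ a k, HasSum (fun ν : ℤ => ∑ b, H ν a b • X b (k - ν)) (Y a k)

lemma JointlyStationary.add_int {Y : κ → L2Seq P} {Z : κ' → L2Seq P} (h : JointlyStationary Y Z)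
    (a : κ) (b : κ') (s t d : ℤ) : corr (Y a) (Z b) (s + d) (t + d) = corr (Y a) (Z b) s t := by
  induction d using Int.induction_on with
  | zero => simp
  | succ n ih => rw [← add_assoc, ← add_assoc, h, ih]
  | pred n ih => rw [← ih, ← h, add_assoc, add_assoc, sub_add_cancel]

lemma JointlyStationary.corr_neg {Y : κ → L2Seq P} {Z : κ' → L2Seq P} (h : JointlyStationary Y Z)
    (a : κ) (b : κ') (τ : ℤ) :
    corr (Z b) (Y a) τ 0 = (starRingEnd ℂ) (corr (Y a) (Z b) (-τ) 0) := by
  rw [conj_corr, ← conj_corr, ← h.add_int a b 0 τ (-τ), conj_corr]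
  simp

lemma HasCrossSpectrum.symm {Y : κ → L2Seq P} {Z : κ' → L2Seq P} (hs : HasCrossSpectrum Y Z)
    (h : JointlyStationary Y Z) : HasCrossSpectrum Z Y := by
  intro b a
  simp only [h.corr_neg]
  exact (((Equiv.neg ℤ).summable_iff).2 (hs a b)).star

lemma crossSpectrum_symm {Y : κ → L2Seq P} {Z : κ' → L2Seq P} (h : JointlyStationary Y Z)
    (ω : ℝ) : crossSpectrum Z Y ω = (crossSpectrum Y Z ω).conjTranspose := by
  ext b a
  simp only [crossSpectrum, Matrix.of_apply, Matrix.conjTranspose_apply, h.corr_neg]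
  rw [tsum_star, ← (Equiv.neg ℤ).tsum_eq]
  simp [star_fchar]

variable [Fintype κ']

/-- Correlating against the fixed vector `z t` is a continuous linear functional on `L²`, so it
passes through the convergent series. -/
lemma IsMatrixFiltered.hasSum_corr {H : ℤ → Matrix κ κ' ℂ} {X : κ' → L2Seq P} {Y : κ → L2Seq P}
    (h : IsMatrixFiltered H X Y) (z : L2Seq P) (a : κ) (s t : ℤ) :
    HasSum (fun ν : ℤ => ∑ b, H ν a b * corr (X b) z (s - ν) t) (corr (Y a) z s t) := by
  simpa [corr_eq_inner, inner_sum, inner_smul_right] using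
    (h a s).mapL (innerSL ℂ (z t))

lemma IsMatrixFiltered.jointlyStationary {H : ℤ → Matrix κ κ' ℂ} {X : κ' → L2Seq P}
    {Y : κ → L2Seq P} (h : IsMatrixFiltered H X Y) {Z : κ'' → L2Seq P}
    (hX : JointlyStationary X Z) : JointlyStationary Y Z := by
  intro a b s t
  refine (h.hasSum_corr (Z b) a (s + 1) (t + 1)).unique ?_
  convert h.hasSum_corr (Z b) a s t using 4 with ν c
  rw [add_sub_right_comm, hX]

lemma summable_mul_shift {f g : ℤ → ℂ} (hf : Summable f) (hg : Summable g) (τ : ℤ) :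
    Summable fun ν => f ν * g (τ - ν) := by
  have h := (summable_mul_of_summable_norm hf.norm hg.norm)
  exact h.comp_injective (i := fun ν : ℤ => (ν, τ - ν)) fun x y hxy => congrArg Prod.fst hxy

lemma IsMatrixFiltered.hasSum_crossSpectrum {H : ℤ → Matrix κ κ' ℂ} {X : κ' → L2Seq P}
    {Y : κ → L2Seq P} (h : IsMatrixFiltered H X Y) (hH : ∀ a b, Summable fun ν => H ν a b)
    {Z : κ'' → L2Seq P} (hX : HasCrossSpectrum X Z) (ω : ℝ) (a : κ) (b : κ'') :
    HasSum (fun τ => corr (Y a) (Z b) τ 0 * fchar ω τ)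
      ((transferMatrix H ω * crossSpectrum X Z ω) a b) := by
  rw [Matrix.mul_apply]
  convert hasSum_sum fun c (_ : c ∈ Finset.univ) =>
    hasSum_conv_mul_fchar (hH a c) (hX c b) ω using 2 with τ
  rw [← Finset.sum_mul, ← Summable.tsum_finsetSum, (h.hasSum_corr (Z b) a τ 0).tsum_eq]
  · exact fun c _ => summable_mul_shift (hH a c) (hX c b) τ
  · rfl

lemma IsMatrixFiltered.hasCrossSpectrum {H : ℤ → Matrix κ κ' ℂ} {X : κ' → L2Seq P}
    {Y : κ → L2Seq P} (h : IsMatrixFiltered H X Y) (hH : ∀ a b, Summable fun ν => H ν a b)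
    {Z : κ'' → L2Seq P} (hX : HasCrossSpectrum X Z) : HasCrossSpectrum Y Z :=
  fun a b => (summable_mul_fchar 0).1 (h.hasSum_crossSpectrum hH hX 0 a b).summable

lemma IsMatrixFiltered.crossSpectrum_eq {H : ℤ → Matrix κ κ' ℂ} {X : κ' → L2Seq P}
    {Y : κ → L2Seq P} (h : IsMatrixFiltered H X Y) (hH : ∀ a b, Summable fun ν => H ν a b)
    {Z : κ'' → L2Seq P} (hX : HasCrossSpectrum X Z) (ω : ℝ) :
    crossSpectrum Y Z ω = transferMatrix H ω * crossSpectrum X Z ω := by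
  ext a b
  exact (h.hasSum_crossSpectrum hH hX ω a b).tsum_eq

lemma corr_sub_left (x y z : L2Seq P) (s t : ℤ) :
    corr (x - y) z s t = corr x z s t - corr y z s t := by
  simp [corr_eq_inner, inner_sub_right]

/-- The spectral factorisation `Φ_E = (1 - H) Φ_X (1 - H)^*` for a process with `X = H * X + E`. -/
theorem psd_factorization [DecidableEq κ'] {H : ℤ → Matrix κ' κ' ℂ} {X E : κ' → L2Seq P}
    (h : IsMatrixFiltered H X (X - E)) (hH : ∀ a b, Summable fun ν => H ν a b)
    (hX : HasPSD X) (hst : JointlyStationary X X) (ω : ℝ) :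
    psd E ω = (1 - transferMatrix H ω) * psd X ω * (1 - transferMatrix H ω).conjTranspose := by
  -- Replacing `X` by `E` in the first argument multiplies the cross spectrum on the left by `1 -
  -- H`. This is used with `Z = X`, and again with `Z = E` after exchanging the arguments by
  -- Hermitian symmetry.
  have key : ∀ {Z : κ' → L2Seq P}, HasCrossSpectrum X Z → JointlyStationary X Z →
      HasCrossSpectrum E Z ∧ JointlyStationary E Z ∧
        crossSpectrum E Z ω = (1 - transferMatrix H ω) * crossSpectrum X Z ω := by
    intro Z hXZ hst'
    have e : E = X - (X - E) := by simp
    have hc : ∀ a b s t, corr (E a) (Z b) s t =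
        corr (X a) (Z b) s t - corr ((X - E) a) (Z b) s t := by
      intro a b s t
      rw [← corr_sub_left, ← Pi.sub_apply, ← e]
    have hY := h.hasCrossSpectrum hH hXZ
    refine ⟨fun a b => ?_, fun a b s t => ?_, ?_⟩
    · simp only [hc]
      exact (hXZ a b).sub (hY a b)
    · rw [hc, hc, hst', h.jointlyStationary hst']
    · rw [sub_mul, one_mul, ← h.crossSpectrum_eq hH hXZ]
      ext a b
      simp only [crossSpectrum, Matrix.of_apply, Matrix.sub_apply, hc, sub_mul]
      exact Summable.tsum_sub ((summable_mul_fchar ω).2 (hXZ a b))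
        ((summable_mul_fchar ω).2 (hY a b))
  obtain ⟨h1, h2, h3⟩ := key hX hst
  have hst2 : JointlyStationary X E := by
    intro a b s t
    rw [← conj_corr, h2, conj_corr]
  obtain ⟨-, -, h4⟩ := key (h1.symm h2) hst2
  change crossSpectrum E E ω = _ * crossSpectrum X X ω * _
  rw [h4, crossSpectrum_symm h2, h3, Matrix.conjTranspose_mul, ← crossSpectrum_symm hst,
    Matrix.mul_assoc]

end

/-! ### The node filters -/

open Filter Topology in
lemma tendsto_norm_bilinear {dt : ℝ} (hdt : 0 < dt) :
    Tendsto (fun u : ℂ => ‖2 * (1 - u) / (dt * (1 + u))‖) (𝓝[≠] (-1)) atTop := by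
  have h1 : Tendsto (fun u : ℂ => ‖(dt : ℂ) * (1 + u)‖⁻¹) (𝓝[≠] (-1)) atTop := by
    refine tendsto_inv_nhdsGT_zero.comp (tendsto_nhdsWithin_iff.2 ⟨?_, ?_⟩)
    · have : Continuous fun u : ℂ => ‖(dt : ℂ) * (1 + u)‖ := by fun_prop
      simpa using (this.tendsto (-1)).mono_left nhdsWithin_le_nhds
    · filter_upwards [self_mem_nhdsWithin] with u hu
      have : (1 + u) ≠ 0 := fun h => hu (by rw [Set.mem_singleton_iff]; linear_combination h)
      simp [this, hdt.ne']
  have h2 : Tendsto (fun u : ℂ => ‖2 * (1 - u)‖) (𝓝[≠] (-1)) (𝓝 4) := by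
    have : Continuous fun u : ℂ => ‖2 * (1 - u)‖ := by fun_prop
    have h := (this.tendsto (-1)).mono_left (nhdsWithin_le_nhds (s := {-1}ᶜ))
    convert h using 2
    norm_num
  simpa [div_eq_mul_inv] using h2.pos_mul_atTop (by norm_num) h1

/-- The transform sends the disc to the right half plane, where a stable polynomial has no root. At
`u = -1` division by zero gives the value `0`, so that point needs no exception. -/
lemma bilinear_re_nonneg {dt : ℝ} (hdt : 0 < dt) {u : ℂ} (hu : ‖u‖ ≤ 1) :
    0 ≤ (2 * (1 - u) / (dt * (1 + u))).re := by
  have h : u.re * u.re + u.im * u.im ≤ 1 := by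
    rw [← Complex.normSq_apply, Complex.normSq_eq_norm_sq]
    nlinarith [norm_nonneg u]
  rw [Complex.div_re, ← add_div]
  refine div_nonneg ?_ (Complex.normSq_nonneg _)
  simp
  nlinarith

/-- The reciprocal of a stable polynomial, composed with the bilinear transform, extends to an
analytic function on a neighbourhood of the closed unit disc. -/
lemma exists_analytic_bilinear {dt : ℝ} (hdt : 0 < dt) {a : Polynomial ℂ} (ha : 0 < a.natDegree)
    (hroot : ∀ s : ℂ, a.IsRoot s → s.re < 0) :
    ∃ g : ℂ → ℂ, (∀ u, ‖u‖ ≤ 1 → AnalyticAt ℂ g u) ∧ g (-1) = 0 ∧ g 0 ≠ 0 ∧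
      ∀ u, u ≠ -1 → g u = 1 / a.eval (2 * (1 - u) / (dt * (1 + u))) := by
  have hdt' : (dt : ℂ) ≠ 0 := by exact_mod_cast hdt.ne'
  have hne : ∀ u : ℂ, ‖u‖ ≤ 1 → a.eval (2 * (1 - u) / (dt * (1 + u))) ≠ 0 := fun u hu h0 =>
    absurd (hroot _ h0) (not_lt.2 (bilinear_re_nonneg hdt hu))
  have hlim := a.tendsto_norm_atTop (Polynomial.natDegree_pos_iff_degree_pos.1 ha)
    (tendsto_norm_bilinear hdt)
  set g : ℂ → ℂ := Function.update (fun u => 1 / a.eval (2 * (1 - u) / (dt * (1 + u)))) (-1) 0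
    with hg
  have hgu : ∀ u : ℂ, u ≠ -1 → g u = 1 / a.eval (2 * (1 - u) / (dt * (1 + u))) := fun u hu => by
    simp [hg, Function.update_of_ne hu]
  have hd : ∀ u : ℂ, u ≠ -1 → a.eval (2 * (1 - u) / (dt * (1 + u))) ≠ 0 →
      DifferentiableAt ℂ g u := by
    intro u hu h0
    have h1 : (dt : ℂ) * (1 + u) ≠ 0 :=
      mul_ne_zero hdt' fun h => hu (by linear_combination h)
    have h2 : DifferentiableAt ℂ (fun u : ℂ => 2 * (1 - u) / (dt * (1 + u))) u := by
      fun_prop (disch := exact h1)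
    have h3 : DifferentiableAt ℂ (fun u : ℂ => 1 / a.eval (2 * (1 - u) / (dt * (1 + u)))) u :=
      (differentiableAt_const _).div (a.differentiable.differentiableAt.comp u h2) h0
    refine h3.congr_of_eventuallyEq ?_
    filter_upwards [isOpen_ne.mem_nhds hu] with v hv using hgu v hv
  have hev : ∀ u : ℂ, u ≠ -1 → a.eval (2 * (1 - u) / (dt * (1 + u))) ≠ 0 → AnalyticAt ℂ g u := by
    intro u hu h0
    have h1 : (dt : ℂ) * (1 + u) ≠ 0 :=
      mul_ne_zero hdt' fun h => hu (by linear_combination h)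
    have h2 : ContinuousAt (fun u : ℂ => 2 * (1 - u) / (dt * (1 + u))) u := by
      fun_prop (disch := exact h1)
    have h3 : ContinuousAt (fun u : ℂ => a.eval (2 * (1 - u) / (dt * (1 + u)))) u :=
      a.continuous.continuousAt.comp h2
    refine analyticAt_iff_eventually_differentiableAt.2 ?_
    filter_upwards [isOpen_ne.mem_nhds hu, h3.eventually_ne h0] with v hv hv0 using hd v hv hv0
  refine ⟨g, fun u hu => ?_, by simp [hg], ?_, hgu⟩
  · rcases eq_or_ne u (-1) with rfl | h
    -- Removable singularity: the polynomial has positive degree and its argument tends to infinity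
    -- at `-1`, so the reciprocal tends to `0`, the value assigned there.
    · refine analyticAt_of_differentiable_on_punctured_nhds_of_continuousAt ?_ ?_
      · filter_upwards [self_mem_nhdsWithin, hlim.eventually_gt_atTop 0] with v hv hv0
        exact hd v hv (norm_pos_iff.1 hv0)
      · rw [hg, continuousAt_update_same, tendsto_zero_iff_norm_tendsto_zero]
        simpa [Pi.inv_def] using hlim.inv_tendsto_atTop
    · exact hev u h (hne u hu)
  · rw [hgu 0 (by norm_num)]
    exact one_div_ne_zero (hne 0 (by simp))

/-- By compactness, analyticity extends to a disc of radius larger than `1`; the Taylor coefficients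
are therefore absolutely summable on the closed unit disc. -/
lemma exists_powerSeries_of_analyticAt {g : ℂ → ℂ} (hg : ∀ u, ‖u‖ ≤ 1 → AnalyticAt ℂ g u) :
    ∃ c : ℕ → ℂ, Summable c ∧ ∀ u, ‖u‖ ≤ 1 → HasSum (fun n => c n * u ^ n) (g u) := by
  obtain ⟨δ, hδ, hsub⟩ := (isCompact_closedBall (0 : ℂ) 1).exists_cthickening_subset_open
    (isOpen_analyticAt ℂ g) fun u hu => hg u (by simpa using hu)
  rw [cthickening_closedBall hδ.le zero_le_one] at hsub
  obtain ⟨r, hr⟩ : ∃ r : NNReal, (r : ℝ) = δ + 1 := ⟨⟨δ + 1, by positivity⟩, rfl⟩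
  rw [← hr] at hsub
  have hr1 : (1 : NNReal) < r := NNReal.coe_lt_coe.1 (by simpa [hr] using hδ)
  have hdiff : DifferentiableOn ℂ g (Metric.closedBall 0 (r : ℝ)) :=
    fun u hu => (hsub hu).differentiableAt.differentiableWithinAt
  have hp := hdiff.hasFPowerSeriesOnBall (zero_lt_one.trans hr1)
  set q := cauchyPowerSeries g 0 (r : ℝ)
  have h1 : ((1 : NNReal) : ENNReal) < (r : ENNReal) := ENNReal.coe_lt_coe.2 hr1
  refine ⟨q.coeff, ?_, fun u hu => ?_⟩
  · have := q.summable_norm_mul_pow (h1.trans_le hp.r_le)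
    refine Summable.of_norm ?_
    simpa [FormalMultilinearSeries.norm_apply_eq_norm_coef] using this
  · have hmem : u ∈ Metric.eball (0 : ℂ) (r : ENNReal) := by
      rw [Metric.mem_eball, edist_zero_right]
      refine lt_of_le_of_lt ?_ h1
      exact ENNReal.coe_le_coe.2 (NNReal.coe_le_coe.1 (by simpa using hu))
    simpa [FormalMultilinearSeries.apply_eq_pow_smul_coeff, mul_comm] using hp.hasSum hmem

lemma integral_exp_int (k : ℤ) :
    ∫ ω in (0 : ℝ)..(2 * Real.pi), exp (I * ω * k) = if k = 0 then (2 * Real.pi : ℂ) else 0 := by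
  split_ifs with h
  · simp [h]
  · have hc : (I * k : ℂ) ≠ 0 := mul_ne_zero I_ne_zero (by exact_mod_cast h)
    have h1 := integral_exp_mul_complex (a := 0) (b := 2 * Real.pi) hc
    have h2 : exp (I * k * ((2 * Real.pi : ℝ) : ℂ)) = 1 := by
      rw [Complex.exp_eq_one_iff]
      exact ⟨k, by push_cast; ring⟩
    rw [h2] at h1
    simpa [mul_right_comm, mul_assoc, mul_comm, mul_left_comm] using h1

/-- The inverse `z`-transform of a power series in `z⁻¹`. -/
lemma invZ_of_powerSeries {c : ℕ → ℂ} (hc : Summable c) {F : ℂ → ℂ}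
    (hF : ∀ u : ℂ, ‖u‖ = 1 → u ≠ -1 → F u⁻¹ = ∑' n, c n * u ^ n) (n : ℤ) :
    LDM.invZ F n = if 0 ≤ n then c n.toNat else 0 := by
  have hsum : HasSum (fun m : ℕ => ∫ ω in (0 : ℝ)..(2 * Real.pi), c m * exp (I * ω * (n - m : ℤ)))
      (∫ ω in (0 : ℝ)..(2 * Real.pi), F (exp (I * ω)) * exp (I * ω * n)) := by
    refine intervalIntegral.hasSum_integral_of_dominated_convergence (fun m _ => ‖c m‖)
      (fun m => (Continuous.aestronglyMeasurable (by fun_prop))) (fun m => ?_) ?_ ?_ ?_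
    · refine Filter.Eventually.of_forall fun ω _ => ?_
      simp [Complex.norm_exp]
    · exact Filter.Eventually.of_forall fun _ _ => hc.norm
    · exact _root_.intervalIntegrable_const
    -- The excluded value `u = -1` is attained on `(0, 2π]` only at `ω = π`: the integer bounds
    -- below force `k = -1`.
    · have hπ : ∀ᵐ ω : ℝ, ω ≠ Real.pi := by simp [ae_iff]
      filter_upwards [hπ] with ω h1 h2
      rw [Set.uIoc_of_le (by positivity)] at h2
      have hu : ‖exp (-(I * ω))‖ = 1 := by simp [Complex.norm_exp]
      have hu1 : exp (-(I * ω)) ≠ -1 := by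
        intro h
        rw [← Complex.exp_pi_mul_I, Complex.exp_eq_exp_iff_exists_int] at h
        obtain ⟨k, hk⟩ := h
        have h3 := congrArg Complex.im hk
        simp at h3
        have h4 : -1 < -1 - 2 * (k : ℝ) + 1 := by
          have := h2.1
          nlinarith [Real.pi_pos]
        have h5 : -1 - 2 * (k : ℝ) ≤ 2 := by
          have := h2.2
          nlinarith [Real.pi_pos]
        have h6 : k = -1 := by
          have h7 : k < 1 := by exact_mod_cast (by linarith : (k : ℝ) < 1)
          have h8 : (-2 : ℤ) < k := by exact_mod_cast (by linarith : (-2 : ℝ) < k)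
          have h9 : k ≠ 0 := by
            rintro rfl
            have := h2.1
            push_cast at h3
            nlinarith [Real.pi_pos]
          omega
        rw [h6] at h3
        push_cast at h3
        exact h1 (by linarith)
      have h3 := hF _ hu hu1
      rw [← Complex.exp_neg, neg_neg] at h3
      rw [h3]
      have h4 : Summable fun m => c m * exp (-(I * ω)) ^ m := by
        refine Summable.of_norm ?_
        simpa [hu] using hc.norm
      have h5 : (fun m : ℕ => c m * exp (I * ω * (n - m : ℤ))) =
          fun m => c m * exp (-(I * ω)) ^ m * exp (I * ω * n) := by
        funext m
        rw [← Complex.exp_nat_mul, mul_assoc (c m) (exp _), ← Complex.exp_add]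
        push_cast
        ring_nf
      rw [h5]
      exact h4.hasSum.mul_right _
  simp only [intervalIntegral.integral_const_mul, integral_exp_int] at hsum
  have h0 : (2 * Real.pi : ℂ) ≠ 0 := by exact_mod_cast Real.two_pi_pos.ne'
  rw [LDM.invZ, ← hsum.tsum_eq]
  split_ifs with hn
  · rw [tsum_eq_single n.toNat]
    · rw [if_pos (by omega)]
      field_simp
    · intro m hm
      rw [if_neg (by omega), mul_zero]
  · rw [tsum_eq_single 0] <;> intros <;> rw [if_neg (by omega)] <;> simp

namespace LDM

variable {m : ℕ}

/-- The impulse response of `1 / Sᵢ`. -/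
noncomputable def nodeFilter (L : LDM m) (i : Fin m) : ℤ → ℂ := invZ fun z => 1 / L.S i z

/-- The `c n` are the Taylor coefficients of `1 / S` in `u = z⁻¹`. Their support on `n ≥ 0` is
causality, `c 0` is the value at `u = 0`, and the vanishing alternating sum is the zero at `z = -1`.
-/
lemma exists_nodeFilter_powerSeries {L : LDM m} (hL : L.IsStable) (i : Fin m) :
    ∃ c : ℕ → ℂ, Summable c ∧ c 0 ≠ 0 ∧ HasSum (fun n => c n * (-1) ^ n) 0 ∧
      ∀ n : ℤ, L.nodeFilter i n = if 0 ≤ n then c n.toNat else 0 := by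
  obtain ⟨g, hg, hg1, hg0, hgu⟩ := exists_analytic_bilinear hL.1 (hL.2 i).1 (hL.2 i).2
  obtain ⟨c, hc, hcg⟩ := exists_powerSeries_of_analyticAt hg
  refine ⟨c, hc, ?_, ?_, invZ_of_powerSeries hc fun u hu hu1 => ?_⟩
  · have h := (hcg 0 (by simp)).tsum_eq
    rw [tsum_eq_single 0 (fun n hn => by simp [hn])] at h
    rw [pow_zero, mul_one] at h
    rwa [h]
  · simpa [hg1] using hcg (-1) (by simp)
  · rw [(hcg u hu.le).tsum_eq, hgu u hu1, S, inv_inv]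

end LDM

/-! ### Lifted filters -/

/-- The substitution `n = νT + p - q`. -/
def liftEquiv (T : ℕ) [NeZero T] (p : Fin T) : ℤ × Fin T ≃ ℤ :=
  (((Equiv.neg ℤ).prodCongr (Equiv.refl (Fin T))).trans (Int.divModEquiv T).symm).trans
    (Equiv.subLeft ((p : ℕ) : ℤ))

lemma liftEquiv_apply (T : ℕ) [NeZero T] (p q : Fin T) (ν : ℤ) :
    liftEquiv T p (ν, q) = ν * T + p - q := by
  simp [liftEquiv, Int.divModEquiv]
  ring

/-- The matrix-valued impulse response of the lift of a scalar filter. -/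
def liftImpulse (T : ℕ) (h : ℤ → ℂ) (ν : ℤ) : Matrix (Fin T) (Fin T) ℂ :=
  Matrix.of fun p q => h (ν * T + p - q)

/-- The lift of a causal filter, as a function of `w = e^{-iω}`. -/
noncomputable def causalLift (T : ℕ) (h : ℤ → ℂ) (w : ℂ) : Matrix (Fin T) (Fin T) ℂ :=
  Matrix.of fun p q => ∑' n : ℕ, h (n * T + p - q) * w ^ n

section

variable {T : ℕ} {h : ℤ → ℂ}

lemma lift_index_neg (hT : 0 < T) {ν : ℤ} (hν : ν < 0) (p q : Fin T) : ν * T + p - q < 0 := by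
  have h1 : ν * T ≤ (-1) * T := by
    apply mul_le_mul_of_nonneg_right <;> omega
  have := p.2
  omega

lemma transferMatrix_eq_causalLift (hT : 0 < T) (hneg : ∀ n < 0, h n = 0) (ω : ℝ) :
    transferMatrix (liftImpulse T h) ω = causalLift T h (exp (-(I * ω))) := by
  ext p q
  simp only [transferMatrix, causalLift, liftImpulse, Matrix.of_apply]
  rw [← (Nat.cast_injective (R := ℤ)).tsum_eq]
  · congr 1 with n
    rw [fchar, ← Complex.exp_nat_mul]
    push_cast
    ring_nf
  · intro ν hν
    by_contra hc
    refine hν ?_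
    have : ν < 0 := by
      by_contra h0
      exact hc ⟨ν.toNat, by simp; omega⟩
    simp [hneg _ (lift_index_neg hT this p q)]

lemma lift_injective (hT : 0 < T) (p q : Fin T) :
    Function.Injective fun ν : ℤ => ν * T + p - q := by
  intro a b hab
  have : a * T = b * T := by simpa using hab
  exact mul_right_cancel₀ (by exact_mod_cast hT.ne') this

lemma summable_liftImpulse (hT : 0 < T) (hh : Summable h) (p q : Fin T) :
    Summable fun ν => liftImpulse T h ν p q :=
  hh.comp_injective (lift_injective hT p q)

/-- Each entry is a power series with absolutely summable coefficients, hence converges uniformly on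
the closed disc. -/
lemma diffContOnCl_det_causalLift (hT : 0 < T) (hh : Summable h) :
    DiffContOnCl ℂ (fun w => (causalLift T h w).det) (Metric.ball 0 1) := by
  have hs : ∀ p q : Fin T, Summable fun n : ℕ => ‖h (n * T + p - q)‖ := fun p q =>
    (hh.norm.comp_injective (lift_injective hT p q)).comp_injective
      (Nat.cast_injective (R := ℤ))
  have hb : ∀ (p q : Fin T) (n : ℕ) (w : ℂ), ‖w‖ ≤ 1 →
      ‖h (n * T + p - q) * w ^ n‖ ≤ ‖h (n * T + p - q)‖ := by
    intro p q n w hw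
    rw [norm_mul, norm_pow]
    exact mul_le_of_le_one_right (norm_nonneg _) (pow_le_one₀ (norm_nonneg _) hw)
  have hd : ∀ p q : Fin T, DiffContOnCl ℂ (fun w => causalLift T h w p q) (Metric.ball 0 1) := by
    intro p q
    refine DiffContOnCl.mk_ball ?_ ?_
    · exact differentiableOn_tsum_of_summable_norm (hs p q) (fun n => by fun_prop)
        Metric.isOpen_ball fun n w hw => hb p q n w (by simpa using (mem_ball_zero_iff.1 hw).le)
    · exact continuousOn_tsum (fun n => by fun_prop) (hs p q)
        fun n w hw => hb p q n w (by simpa using hw)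
  simp only [Matrix.det_apply]
  refine ⟨?_, ?_⟩
  · exact DifferentiableOn.fun_sum fun σ _ =>
      (DifferentiableOn.fun_finsetProd fun i _ => (hd _ _).1).const_smul _
  · exact continuousOn_finsetSum _ fun σ _ =>
      (continuousOn_finsetProd _ fun i _ => (hd _ _).2).const_smul _

/-- At `w = 0` only the entries `h (p - q)` remain; by causality they form a lower triangular matrix
with `h 0` on the diagonal. -/
lemma det_causalLift_zero (hneg : ∀ n < 0, h n = 0) : (causalLift T h 0).det = h 0 ^ T := by
  have he : ∀ p q : Fin T, causalLift T h 0 p q = h (p - q) := by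
    intro p q
    simp only [causalLift, Matrix.of_apply]
    rw [tsum_eq_single 0 fun n hn => by simp [hn]]
    simp
  rw [Matrix.det_of_isLowerTriangular]
  · simp [he]
  · intro p q hpq
    rw [he, hneg]
    have : p < q := hpq
    omega

lemma fchar_neg_of_int (q : ℤ) : fchar Real.pi (-q) = fchar Real.pi q := by
  rw [fchar, fchar, Complex.exp_eq_exp_iff_exists_int]
  exact ⟨q, by push_cast; ring⟩

/-- A filter with a zero at `z = -1` has a lift with a singular transfer matrix. -/
lemma det_transferMatrix_lift_eq_zero [NeZero T] (hh : Summable h)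
    (h0 : ∑' n, h n * fchar Real.pi n = 0) :
    (transferMatrix (liftImpulse T h) (T * Real.pi)).det = 0 := by
  rw [← Matrix.exists_mulVec_eq_zero_iff]
  -- The kernel vector is one period block of the signal `n ↦ (-1)^n`, which the filter annihilates.
  -- From one block to the next this signal is multiplied by `e^{iπT}`, which explains the frequency
  -- `Tπ`.
  refine ⟨fun q => fchar Real.pi (-(q : ℕ)), fun hz => ?_, ?_⟩
  · have h1 := congrFun hz 0
    have h2 := norm_fchar Real.pi (-((0 : Fin T) : ℕ))
    rw [h1] at h2
    simp at h2
  · ext p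
    have hterm : ∀ (ν : ℤ) (q : Fin T),
        fchar Real.pi (-(p : ℕ)) * ((fun n => h n * fchar Real.pi n) (liftEquiv T p (ν, q))) =
        h (ν * T + p - q) * fchar (T * Real.pi) ν * fchar Real.pi (-(q : ℕ)) := by
      intro ν q
      have e1 : fchar (T * Real.pi) ν = fchar Real.pi (ν * T) := by
        simp only [fchar]
        push_cast
        ring_nf
      simp only [liftEquiv_apply]
      rw [e1, sub_eq_add_neg, fchar_add, fchar_add]
      have e2 : fchar Real.pi (-(p : ℕ)) * fchar Real.pi (p : ℕ) = 1 := by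
        rw [← fchar_add]
        simp [fchar]
      linear_combination (h (ν * T + p + -q) * fchar Real.pi (ν * T) *
        fchar Real.pi (-(q : ℕ))) * e2
    have hs := ((liftEquiv T p).hasSum_iff).2 ((summable_mul_fchar Real.pi).2 hh).hasSum
    rw [h0] at hs
    have hs2 := hs.mul_left (fchar Real.pi (-(p : ℕ)))
    rw [mul_zero] at hs2
    have hs3 : HasSum (fun x : ℤ × Fin T => h (x.1 * T + p - x.2) * fchar (T * Real.pi) x.1 *
        fchar Real.pi (-((x.2 : ℕ) : ℤ))) 0 := by
      rw [← funext fun x : ℤ × Fin T => hterm x.1 x.2]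
      exact hs2
    have hs4 := (((Equiv.prodComm (Fin T) ℤ).hasSum_iff).2 hs3).prod_fiberwise (fun q =>
      (((summable_mul_fchar (T * Real.pi)).2
        (hh.comp_injective (lift_injective (NeZero.pos T) p q))).hasSum.mul_right
          (fchar Real.pi (-((q : ℕ) : ℤ)))))
    simpa [Matrix.mulVec, dotProduct, transferMatrix, liftImpulse] using
      (hasSum_fintype _).unique hs4

/-! ### Phase variation of the determinant of a lifted filter -/

/-- A function analytic in the disc whose values on the circle have constant phase modulo `π` is
constant. -/
lemma exists_im_mul_conj_ne_zero {d : ℂ → ℂ} (hd : DiffContOnCl ℂ d (Metric.ball 0 1))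
    (h0 : d 0 ≠ 0) {w₀ : ℂ} (hw₀ : ‖w₀‖ = 1) (h1 : d w₀ = 0) :
    ∃ w w', ‖w‖ = 1 ∧ ‖w'‖ = 1 ∧ (d w * (starRingEnd ℂ) (d w')).im ≠ 0 := by
  by_contra! hcon
  have hfr : frontier (Metric.ball (0 : ℂ) 1) = Metric.sphere 0 1 := frontier_ball 0 one_ne_zero
  have hcl : closure (Metric.ball (0 : ℂ) 1) = Metric.closedBall 0 1 := closure_ball 0 one_ne_zero
  have hz : ∀ w', ‖w'‖ = 1 → d w' = 0 := by
    intro w' hw'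
    set k := (starRingEnd ℂ) (d w') with hk
    have hf : DiffContOnCl ℂ (fun w => d w * k) (Metric.ball 0 1) :=
      ⟨hd.1.mul_const k, hd.2.mul continuousOn_const⟩
    have him : ∀ w ∈ Metric.ball (0 : ℂ) 1, (d w * k).im = 0 := by
      -- On the circle `d w * k` is real, so `exp (s * (d w * k))` has modulus `1` for imaginary
      -- `s`. The maximum principle with `s = ±I` bounds the imaginary part inside the disc from
      -- both sides by `0`.
      have hexp : ∀ s : ℂ, s.re = 0 → ∀ w ∈ Metric.ball (0 : ℂ) 1,
          ‖exp (s * (d w * k))‖ ≤ 1 := by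
        intro s hs w hw
        have hg : DiffContOnCl ℂ (fun w => exp (s * (d w * k))) (Metric.ball 0 1) :=
          Complex.differentiable_exp.comp_diffContOnCl
            ⟨hf.1.const_mul s, continuousOn_const.mul hf.2⟩
        refine norm_le_of_forall_mem_frontier_norm_le Metric.isBounded_ball hg ?_
          (subset_closure hw)
        intro z hz
        rw [hfr] at hz
        have := hcon z w' (by simpa using hz) hw'
        rw [Complex.norm_exp, Complex.mul_re, hs, this]
        simp
      intro w hw
      have h2 := hexp I (by simp) w hw
      have h3 := hexp (-I) (by simp) w hw
      rw [Complex.norm_exp, Real.exp_le_one_iff] at h2 h3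
      rw [Complex.mul_re, I_re, I_im] at h2
      rw [Complex.mul_re, neg_re, neg_im, I_re, I_im] at h3
      linarith
    have han : AnalyticOnNhd ℂ (fun w => d w * k) (Metric.ball 0 1) :=
      hf.1.analyticOnNhd Metric.isOpen_ball
    obtain ⟨c, hc⟩ := han.eq_const_of_im_eq_const him Metric.isOpen_ball
      ((convex_ball (0 : ℂ) 1).isConnected ⟨0, by simp⟩)
    -- An analytic function with zero imaginary part is constant; the boundary zero `w₀` makes the
    -- constant `0`, and `d 0 ≠ 0` then forces `k = 0`.
    have hmem : w₀ ∈ closure (Metric.ball (0 : ℂ) 1) := by rw [hcl]; simp [hw₀]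
    have hcc : Set.EqOn (fun w => d w * k) (fun _ => c) (closure (Metric.ball 0 1)) :=
      Set.EqOn.of_subset_closure hc hf.2 continuousOn_const subset_closure subset_rfl
    have h4 := hcc hmem
    have h5 := hc 0 (by simp)
    simp only [h1, zero_mul] at h4
    rw [← h4] at h5
    have h6 : k = 0 := (mul_eq_zero.1 h5).resolve_left h0
    simpa [hk] using h6
  refine h0 ?_
  have h7 := eqOn_closure_of_eqOn_frontier Metric.isBounded_ball hd
    (diffContOnCl_const (c := (0 : ℂ))) (fun z hz' => hz z (by rw [hfr] at hz'; simpa using hz'))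
  exact h7 (subset_closure (by simp))

lemma exists_exp_neg_eq {w : ℂ} (hw : ‖w‖ = 1) :
    ∃ ω ∈ Set.Icc (0 : ℝ) (2 * Real.pi), exp (-(I * ω)) = w := by
  obtain ⟨θ, rfl⟩ := (Complex.norm_eq_one_iff w).1 hw
  have hper : Function.Periodic (fun ω : ℝ => exp (-(I * ω))) (2 * Real.pi) := by
    intro x
    simp only
    rw [Complex.exp_eq_exp_iff_exists_int]
    exact ⟨-1, by push_cast; ring⟩
  obtain ⟨y, hy, hxy⟩ := hper.exists_mem_Ico₀ Real.two_pi_pos (-θ)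
  refine ⟨y, Set.Ico_subset_Icc_self hy, ?_⟩
  rw [← hxy]
  push_cast
  ring_nf

/-- The determinant of the lift of a causal filter with `h(0) ≠ 0` and a zero at `z = -1` does not
have constant phase on a set of frequencies of full measure. -/
theorem exists_det_lift_phase_ne [NeZero T] (hh : Summable h) (hneg : ∀ n < 0, h n = 0)
    (h0 : h 0 ≠ 0) (h1 : ∑' n, h n * fchar Real.pi n = 0) {p : ℝ → Prop}
    (hp : ∀ᵐ ω ∂(volume.restrict (Set.Ico (0 : ℝ) (2 * Real.pi))), p ω) :
    ∃ ω ω', p ω ∧ p ω' ∧ ω ∈ Set.Ico (0 : ℝ) (2 * Real.pi) ∧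
      ω' ∈ Set.Ico (0 : ℝ) (2 * Real.pi) ∧
      ((transferMatrix (liftImpulse T h) ω).det *
        (starRingEnd ℂ) (transferMatrix (liftImpulse T h) ω').det).im ≠ 0 := by
  have hT := NeZero.pos T
  set d : ℂ → ℂ := fun w => (causalLift T h w).det with hd
  set D : ℝ → ℂ := fun ω => (transferMatrix (liftImpulse T h) ω).det with hD
  have hDd : ∀ ω : ℝ, D ω = d (exp (-(I * ω))) := fun ω => by
    simp only [hD, hd, transferMatrix_eq_causalLift hT hneg]
  have hdc := diffContOnCl_det_causalLift hT hh
  have hDc : Continuous D := by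
    rw [funext hDd]
    refine hdc.2.comp_continuous (by fun_prop) fun ω => ?_
    rw [closure_ball 0 one_ne_zero]
    simp [Complex.norm_exp]
  obtain ⟨w, w', hw, hw', hne⟩ := exists_im_mul_conj_ne_zero (d := d) hdc
    (by simp only [hd, det_causalLift_zero hneg]; exact pow_ne_zero _ h0)
    (w₀ := exp (-(I * (T * Real.pi : ℝ)))) (by simp [Complex.norm_exp])
    (by rw [← hDd]; exact det_transferMatrix_lift_eq_zero hh h1)
  obtain ⟨ω₁, hω₁, rfl⟩ := exists_exp_neg_eq hw
  obtain ⟨ω₂, hω₂, rfl⟩ := exists_exp_neg_eq hw'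
  rw [← hDd, ← hDd] at hne
  by_contra! hcon
  have hp' : ∀ᵐ ω ∂(volume.restrict (Set.Icc (0 : ℝ) (2 * Real.pi))),
      p ω ∧ ω ∈ Set.Ico (0 : ℝ) (2 * Real.pi) := by
    rw [← restrict_Ico_eq_restrict_Icc]
    filter_upwards [hp, ae_restrict_mem measurableSet_Ico] with ω a b using ⟨a, b⟩
  -- A continuous function vanishing almost everywhere on the interval vanishes on all of it. This
  -- is applied in one frequency at a time, so both frequencies can be chosen where `p` holds.
  have hext : ∀ f : ℝ → ℝ, Continuous f →
      (∀ ω, p ω → ω ∈ Set.Ico (0 : ℝ) (2 * Real.pi) → f ω = 0) →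
      ∀ ω ∈ Set.Icc (0 : ℝ) (2 * Real.pi), f ω = 0 := by
    intro f hf hz
    refine Measure.eqOn_Icc_of_ae_eq volume Real.two_pi_pos.ne ?_ hf.continuousOn
      (continuousOn_const (c := (0 : ℝ)))
    filter_upwards [hp'] with ω hω using hz ω hω.1 hω.2
  refine hne (hext (fun ω => (D ω * (starRingEnd ℂ) (D ω₂)).im) (by fun_prop) ?_ ω₁ hω₁)
  intro ω hpω hω
  exact hext (fun ω' => (D ω * (starRingEnd ℂ) (D ω')).im) (by fun_prop)
    (fun ω' hpω' hω' => hcon ω ω' hpω hpω' hω hω') ω₂ hω₂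

end

namespace LDM

variable {m : ℕ}

/-- These are the hypotheses on the filter in `exists_det_lift_phase_ne`; the last one is the zero
at `z = -1`, as `fchar Real.pi n = (-1)^n`. -/
lemma nodeFilter_props {L : LDM m} (hL : L.IsStable) (i : Fin m) :
    Summable (L.nodeFilter i) ∧ (∀ n < 0, L.nodeFilter i n = 0) ∧ L.nodeFilter i 0 ≠ 0 ∧
      ∑' n, L.nodeFilter i n * fchar Real.pi n = 0 := by
  obtain ⟨c, hc, hc0, hc1, h⟩ := L.exists_nodeFilter_powerSeries hL i
  have hneg : ∀ n < 0, L.nodeFilter i n = 0 := fun n hn => by rw [h, if_neg (by omega)]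
  have hnat : ∀ n : ℕ, L.nodeFilter i n = c n := fun n => by rw [h, if_pos (by omega)]; simp
  have hsupp : ∀ x ∉ Set.range ((↑) : ℕ → ℤ), L.nodeFilter i x = 0 := by
    intro x hx
    refine hneg x ?_
    by_contra h0
    exact hx ⟨x.toNat, by simp; omega⟩
  refine ⟨?_, hneg, ?_, ?_⟩
  · rw [← (Nat.cast_injective (R := ℤ)).summable_iff hsupp]
    simpa [Function.comp_def, hnat] using hc
  · exact_mod_cast (hnat 0).symm ▸ hc0
  · refine HasSum.tsum_eq ?_
    rw [← (Nat.cast_injective (R := ℤ)).hasSum_iff fun x hx => by simp [hsupp x hx]]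
    convert hc1 using 2 with n
    simp only [Function.comp_apply, hnat]
    congr 1
    rw [← Complex.exp_pi_mul_I, ← Complex.exp_nat_mul, ← fchar_neg_of_int, fchar]
    push_cast
    ring_nf

end LDM

/-! ### Zero sets of determinants -/

/-- Let `q` be the product of the first determinant, as a polynomial in `y`, with the second one
with conjugated coefficients. For real `y` the product is real exactly when `q - conj q` vanishes at
`y`, and this polynomial is nonzero because the coefficient of `q` in degree twice the matrix size,
`det A * conj (det A')`, is not real. -/
lemma finite_im_det_mul_conj_eq_zero {n : Type*} [Fintype n] [DecidableEq n]
    (A B A' B' : Matrix n n ℂ) (h : (A.det * (starRingEnd ℂ) A'.det).im ≠ 0) :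
    {y : ℝ | (((y : ℂ) • A + B).det * (starRingEnd ℂ) ((y : ℂ) • A' + B').det).im = 0}.Finite := by
  have key : ∀ A B : Matrix n n ℂ, ∃ p : Polynomial ℂ, p.natDegree ≤ Fintype.card n ∧
      p.coeff (Fintype.card n) = A.det ∧ ∀ y : ℂ, p.eval y = (y • A + B).det := by
    intro A B
    refine ⟨((Polynomial.X : Polynomial ℂ) • A.map Polynomial.C + B.map Polynomial.C).det,
      Polynomial.natDegree_det_X_add_C_le A B, Polynomial.coeff_det_X_add_C_card A B, fun y => ?_⟩
    rw [← Polynomial.coe_evalRingHom, RingHom.map_det]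
    congr 1
    ext r s
    simp [mul_comm (A r s) y]
  obtain ⟨p, hp, hpc, hpe⟩ := key A B
  obtain ⟨p', hp', hpc', hpe'⟩ := key A' B'
  set q := p * p'.map (starRingEnd ℂ) with hq
  have hqe : ∀ y : ℝ, q.eval (y : ℂ) =
      ((y : ℂ) • A + B).det * (starRingEnd ℂ) ((y : ℂ) • A' + B').det := by
    intro y
    rw [hq, Polynomial.eval_mul, hpe, ← hpe']
    congr 1
    conv_lhs => rw [← Complex.conj_ofReal y]
    rw [Polynomial.eval_map_apply]
  have hr : q - q.map (starRingEnd ℂ) ≠ 0 := by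
    intro h0
    have h1 := congrArg (fun r : Polynomial ℂ => r.coeff (Fintype.card n + Fintype.card n)) h0
    have h2 : q.coeff (Fintype.card n + Fintype.card n) = A.det * (starRingEnd ℂ) A'.det := by
      rw [hq, Polynomial.coeff_mul_add_eq_of_natDegree_le hp
        (Polynomial.natDegree_map_le.trans hp'), hpc, Polynomial.coeff_map, hpc']
    simp only [Polynomial.coeff_sub, Polynomial.coeff_map, h2, Polynomial.coeff_zero] at h1
    exact h (Complex.conj_eq_iff_im.1 (sub_eq_zero.1 h1).symm)
  refine ((Polynomial.finite_setOfPred_isRoot hr).preimage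
    Complex.ofReal_injective.injOn).subset fun y hy => ?_
  simp only [Set.mem_preimage, Set.mem_ofPred_eq, Polynomial.IsRoot, Polynomial.eval_sub]
  conv_lhs =>
    rw [← Complex.conj_ofReal y]
    rw [Polynomial.eval_map_apply]
  rw [Complex.conj_ofReal, hqe, sub_eq_zero]
  exact (Complex.conj_eq_iff_im.2 hy).symm

/-- Fubini in `z = x + iy`: for each `x` the set of bad `y` is finite. -/
lemma volume_im_det_mul_conj_eq_zero {n : Type*} [Fintype n] [DecidableEq n]
    (A B A' B' : Matrix n n ℂ) (h : (A.det * (starRingEnd ℂ) A'.det).im ≠ 0) :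
    volume {z : ℂ | ((B - z • A).det * (starRingEnd ℂ) (B' - z • A').det).im = 0} = 0 := by
  have hmeas : MeasurableSet
      {z : ℂ | ((B - z • A).det * (starRingEnd ℂ) (B' - z • A').det).im = 0} :=
    (isClosed_eq (by fun_prop) continuous_const).measurableSet
  rw [← Complex.volume_preserving_equiv_real_prod.symm.measure_preimage hmeas.nullMeasurableSet,
    Measure.volume_eq_prod, Measure.measure_prod_null (Complex.measurableEquivRealProd.symm.measurable hmeas)]
  refine Filter.Eventually.of_forall fun x => Set.Finite.measure_zero ?_ _
  -- Along a vertical line the coefficient of `y` is `-I • A`. The powers of `-I` cancel against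
  -- their conjugates, so the nonreality hypothesis carries over.
  have h1 : (((-I) • A).det * (starRingEnd ℂ) ((-I) • A').det).im ≠ 0 := by
    rw [Matrix.det_smul, Matrix.det_smul, map_mul, mul_mul_mul_comm, map_pow, ← mul_pow]
    simpa using h
  refine (finite_im_det_mul_conj_eq_zero ((-I) • A) (B - (x : ℂ) • A) ((-I) • A')
    (B' - (x : ℂ) • A') h1).subset fun y hy => ?_
  have hz : ∀ A B : Matrix n n ℂ, (y : ℂ) • (-I) • A + (B - (x : ℂ) • A) =
      B - Complex.measurableEquivRealProd.symm (x, y) • A := by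
    intro A B
    rw [Complex.measurableEquivRealProd_symm_apply, Complex.mk_eq_add_mul_I]
    module
  rw [Set.mem_ofPred_eq, hz, hz]
  exact hy

/-- Needed because the weight `b_{ij}` enters the `(j, i)` block through its conjugate; conjugation
preserves Lebesgue measure. -/
lemma volume_im_det_mul_conj_eq_zero' {n : Type*} [Fintype n] [DecidableEq n]
    (A B A' B' : Matrix n n ℂ) (h : (A.det * (starRingEnd ℂ) A'.det).im ≠ 0) :
    volume {z : ℂ | ((B - (starRingEnd ℂ) z • A).det *
      (starRingEnd ℂ) (B' - (starRingEnd ℂ) z • A').det).im = 0} = 0 :=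
  Complex.conjLIE.measurePreserving.quasiMeasurePreserving.preimage_null
    (volume_im_det_mul_conj_eq_zero A B A' B' h)

/-- The determinant is the product of the eigenvalues, hence a nonnegative number times the fixed
factor `∏ exp (c l * I)`, which cancels against its conjugate. Zero eigenvalues fit any phase. -/
lemma HasConstantPhases.im_det_mul_conj_eq_zero {T : ℕ} {F : Set ℝ}
    {M : ℝ → Matrix (Fin T) (Fin T) ℂ} (h : HasConstantPhases F M) {ω ω' : ℝ} (hω : ω ∈ F)
    (hω' : ω' ∈ F) : ((M ω).det * (starRingEnd ℂ) (M ω').det).im = 0 := by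
  obtain ⟨ev, c, hev⟩ := h
  have hdet : ∀ ω ∈ F, (M ω).det = ∏ l, ev ω l := fun ω hω => by
    rw [Matrix.det_eq_prod_roots_charpoly, (hev ω hω).1]
    rfl
  have hpol : ∀ ω ∈ F, ∀ l, ev ω l = ‖ev ω l‖ * exp (c l * I) := by
    intro ω hω l
    rcases eq_or_ne (ev ω l) 0 with h0 | h0
    · simp [h0]
    · rw [← (hev ω hω).2 l h0, Complex.norm_mul_exp_arg_mul_I]
  have hreal : ∀ l, ev ω l * (starRingEnd ℂ) (ev ω' l) =
      ((‖ev ω l‖ * ‖ev ω' l‖ : ℝ) : ℂ) := by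
    intro l
    have h1 : exp (c l * I) * (starRingEnd ℂ) (exp (c l * I)) = 1 := by
      rw [Complex.mul_conj, Complex.normSq_eq_norm_sq, Complex.norm_exp_ofReal_mul_I]
      simp
    conv_lhs => rw [hpol ω hω l, hpol ω' hω' l]
    rw [map_mul, Complex.conj_ofReal]
    push_cast
    linear_combination (‖ev ω l‖ * ‖ev ω' l‖ : ℂ) * h1
  rw [hdet ω hω, hdet ω' hω', map_prod, ← Finset.prod_mul_distrib,
    Finset.prod_congr rfl fun l _ => hreal l, ← Complex.ofReal_prod, Complex.ofReal_im]

/-! ### Block matrices -/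

section

variable {m T : ℕ}

/-- The block diagonal matrix with blocks `W k`. -/
def blockDiag (W : Fin m → Matrix (Fin T) (Fin T) ℂ) :
    Matrix (Fin m × Fin T) (Fin m × Fin T) ℂ :=
  Matrix.of fun a b => if a.1 = b.1 then W a.1 a.2 b.2 else 0

lemma block_mul (A B : Matrix (Fin m × Fin T) (Fin m × Fin T) ℂ) (r s : Fin m) :
    block (A * B) r s = ∑ k, block A r k * block B k s := by
  ext p q
  simp [block, Matrix.mul_apply, Matrix.sum_apply, Fintype.sum_prod_type]

lemma block_blockDiag (W : Fin m → Matrix (Fin T) (Fin T) ℂ) (r s : Fin m) :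
    block (blockDiag W) r s = if r = s then W r else 0 := by
  ext p q
  by_cases h : r = s <;> simp [block, blockDiag, h]

lemma block_conjTranspose (A : Matrix (Fin m × Fin T) (Fin m × Fin T) ℂ) (r s : Fin m) :
    block A.conjTranspose r s = (block A s r).conjTranspose := rfl

lemma block_one (r s : Fin m) :
    block (1 : Matrix (Fin m × Fin T) (Fin m × Fin T) ℂ) r s = if r = s then 1 else 0 := by
  ext p q
  by_cases h : r = s <;> simp [block, h, Matrix.one_apply]

lemma matrix_ext_block {A B : Matrix (Fin m × Fin T) (Fin m × Fin T) ℂ}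
    (h : ∀ r s, block A r s = block B r s) : A = B := by
  ext ⟨r, p⟩ ⟨s, q⟩
  exact congrFun (congrFun (h r s) p) q

lemma blockDiag_mul_eq_one {V W : Fin m → Matrix (Fin T) (Fin T) ℂ} (h : ∀ k, V k * W k = 1) :
    blockDiag V * blockDiag W = 1 := by
  refine matrix_ext_block fun r s => ?_
  rw [block_mul, block_one, Finset.sum_eq_single r]
  · simp only [block_blockDiag, if_true]
    split_ifs <;> simp [h]
  · intro k _ hk
    simp [block_blockDiag, hk.symm]
  · simp

lemma block_congruence (D : Matrix (Fin m × Fin T) (Fin m × Fin T) ℂ)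
    (W : Fin m → Matrix (Fin T) (Fin T) ℂ) (r s : Fin m) :
    block (D.conjTranspose * blockDiag W * D) r s =
      ∑ k, (block D k r).conjTranspose * W k * block D k s := by
  rw [block_mul]
  refine Finset.sum_congr rfl fun k _ => ?_
  rw [block_mul, Finset.sum_eq_single k, block_blockDiag, if_pos rfl, block_conjTranspose]
  · intro l _ hl
    simp [block_blockDiag, hl]
  · simp

/-- A one-sided inverse of a square matrix is two-sided, so the invertibility of `D` and of `Φ`
follows from that of `V` and need not be assumed. -/
lemma inv_of_congruence {n : Type*} [Fintype n] [DecidableEq n] {Φ V W D : Matrix n n ℂ}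
    (h : V = D * Φ * D.conjTranspose) (hVW : V * W = 1) :
    IsUnit Φ ∧ Φ⁻¹ = D.conjTranspose * W * D := by
  have h1 : D * (Φ * D.conjTranspose * W) = 1 := by
    rw [← hVW, h]
    simp only [Matrix.mul_assoc]
  have h2 : Φ * (D.conjTranspose * W * D) = 1 := by
    rw [← mul_eq_one_comm.1 h1]
    simp only [Matrix.mul_assoc]
  exact ⟨IsUnit.of_mul_eq_one _ h2, Matrix.inv_eq_right_inv h2⟩

end

/-! ### The inverse spectrum of the lifted model -/

section

variable {Ω : Type*} [MeasurableSpace Ω] {P : Measure Ω}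

lemma IsFiltered.corr_eq_zero {h : ℤ → ℂ} {x y z : L2Seq P} (hy : IsFiltered h x y)
    (hxz : ∀ s t, corr x z s t = 0) (s t : ℤ) : corr y z s t = 0 := by
  have h1 := (hy s).mapL (innerSL ℂ (z t))
  have h2 : ∀ n, inner ℂ (z t) (x (s - n)) = 0 := fun n => by rw [← corr_eq_inner, hxz]
  simp only [innerSL_apply_apply, inner_smul_right, h2, mul_zero] at h1
  rw [corr_eq_inner]
  exact h1.unique hasSum_zero

namespace LDM

variable {m : ℕ}

lemma IsInput.corr_output_eq_zero {L : LDM m} {per : Fin m → ℕ} {p e : Fin m → L2Seq P}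
    (h : L.IsInput per p e) {i j : Fin m} (hij : i ≠ j) (s t : ℤ) :
    corr (e i) (e j) s t = 0 := by
  refine (h.filtered i).corr_eq_zero (fun s t => ?_) s t
  rw [← conj_corr, (h.filtered j).corr_eq_zero (h.uncorrelated j i hij.symm), map_zero]

lemma IsInput.psd_liftFamily {L : LDM m} {per : Fin m → ℕ} {p e : Fin m → L2Seq P}
    (h : L.IsInput per p e) (T : ℕ) (ω : ℝ) :
    psd (liftFamily T e) ω = blockDiag fun k => psd (liftSeq T (e k)) ω := by
  ext ⟨k, p⟩ ⟨l, q⟩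
  by_cases hkl : k = l
  · subst hkl
    simp [psd, blockDiag, liftFamily]
  · have : ∀ τ, corr (liftFamily T e (k, p)) (liftFamily T e (l, q)) τ 0 = 0 := fun τ =>
      h.corr_output_eq_zero hkl _ _
    simp [psd, blockDiag, hkl, this]

lemma IsInput.period_pos {L : LDM m} {per : Fin m → ℕ} {p e : Fin m → L2Seq P}
    (h : L.IsInput per p e) : 0 < Finset.univ.lcm per := by
  refine Nat.pos_of_ne_zero fun h0 => ?_
  obtain ⟨k, -, hk⟩ := (Finset.lcm_eq_zero_iff).1 h0
  exact (h.wscs k).1.1.ne' hk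

/-- The impulse response of the lift of the transfer matrix. -/
noncomputable def liftedTransfer (L : LDM m) (T : ℕ) (ν : ℤ) :
    Matrix (Fin m × Fin T) (Fin m × Fin T) ℂ :=
  Matrix.of fun a b => invZ (L.transfer a.1 b.1) (ν * T + a.2 - b.2)

lemma invZ_transfer (L : LDM m) (i j : Fin m) (n : ℤ) :
    invZ (L.transfer i j) n = if i = j then 0 else L.b i j * L.nodeFilter i n := by
  by_cases h : i = j
  · simp [invZ, transfer, h]
  · simp only [invZ, nodeFilter, transfer, if_neg h]
    have e : ∀ ω : ℝ, L.b i j / L.S i (exp (I * ω)) * exp (I * ω * n) =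
        L.b i j * (1 / L.S i (exp (I * ω)) * exp (I * ω * n)) := fun ω => by ring
    simp only [e, intervalIntegral.integral_const_mul]
    ring

lemma block_transferMatrix (L : LDM m) (T : ℕ) (ω : ℝ) (k l : Fin m) :
    block (1 - transferMatrix (L.liftedTransfer T) ω) k l =
      if k = l then 1 else -(L.b k l • transferMatrix (liftImpulse T (L.nodeFilter k)) ω) := by
  ext p q
  by_cases h : k = l
  · simp [block, transferMatrix, liftedTransfer, invZ_transfer, h, Matrix.one_apply]
  · simp [block, transferMatrix, liftedTransfer, liftImpulse, invZ_transfer, h, mul_assoc,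
      tsum_mul_left]

lemma summable_liftedTransfer {L : LDM m} (hL : L.IsStable) {T : ℕ} (hT : 0 < T)
    (a b : Fin m × Fin T) : Summable fun ν => L.liftedTransfer T ν a b := by
  by_cases h : a.1 = b.1
  · simp [liftedTransfer, invZ_transfer, h]
  · simpa [liftedTransfer, invZ_transfer, h, liftImpulse] using
      (summable_liftImpulse hT (nodeFilter_props hL a.1).1 a.2 b.2).mul_left (L.b a.1 b.1)

/-- Group the scalar convolution at time `kT + p` by `n = νT + p - q`: then `kT + p - n = (k - ν)T +
q` is entry `q` of block `k - ν`. -/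
lemma IsOutput.isMatrixFiltered {L : LDM m} {T : ℕ} [NeZero T] {e x : Fin m → L2Seq P}
    (h : L.IsOutput T e x) :
    IsMatrixFiltered (L.liftedTransfer T) (liftFamily T x) (liftFamily T x - liftFamily T e) := by
  intro a k
  have h1 := ((liftEquiv T a.2).hasSum_iff).2 (h.dynamics a.1 (k * T + a.2))
  have h2 := h1.prod_fiberwise fun ν => hasSum_fintype _
  have h3 : (fun ν : ℤ => ∑ b, L.liftedTransfer T ν a b • liftFamily T x b (k - ν)) =
      fun ν : ℤ => ∑ q : Fin T, ((fun n : ℤ => ∑ j, invZ (L.transfer a.1 j) n •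
        x j (k * T + a.2 - n)) ∘ liftEquiv T a.2) (ν, q) := by
    funext ν
    rw [Fintype.sum_prod_type_right]
    refine Finset.sum_congr rfl fun q _ => ?_
    simp only [Function.comp_apply, liftEquiv_apply]
    refine Finset.sum_congr rfl fun j _ => ?_
    simp only [liftedTransfer, Matrix.of_apply, liftFamily, liftSeq]
    congr 2
    ring
  rw [h3]
  exact h2

lemma IsOutput.jointlyStationary {L : LDM m} {T : ℕ} {e x : Fin m → L2Seq P}
    (h : L.IsOutput T e x) : JointlyStationary (liftFamily T x) (liftFamily T x) := by
  intro a b s t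
  have := h.cyclostationary.2 a.1 b.1 (s * T + a.2) (t * T + b.2)
  have e : ∀ (s : ℤ) (q : Fin T), (s + 1) * (T : ℤ) + q = s * T + q + T := fun s q => by ring
  simp only [corr, liftFamily, liftSeq, e] at this ⊢
  exact this

/-- The inverse of the power spectral density of the output. -/
theorem IsOutput.inv_psd {L : LDM m} (hL : L.IsStable) {T : ℕ} [NeZero T]
    {e x : Fin m → L2Seq P} (h : L.IsOutput T e x) {ω : ℝ}
    (hE : psd (liftFamily T e) ω = blockDiag fun k => psd (liftSeq T (e k)) ω)
    (hpos : ∀ k, (psd (liftSeq T (e k)) ω).PosDef) (r s : Fin m) :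
    IsUnit (psd (liftFamily T x) ω) ∧ block (psd (liftFamily T x) ω)⁻¹ r s =
      ∑ k, (block (1 - transferMatrix (L.liftedTransfer T) ω) k r).conjTranspose *
        (psd (liftSeq T (e k)) ω)⁻¹ * block (1 - transferMatrix (L.liftedTransfer T) ω) k s := by
  have hf := psd_factorization h.isMatrixFiltered (summable_liftedTransfer hL (NeZero.pos T))
    h.hasPSD h.jointlyStationary ω
  rw [hE] at hf
  obtain ⟨h1, h2⟩ := inv_of_congruence hf (blockDiag_mul_eq_one
    (W := fun k => (psd (liftSeq T (e k)) ω)⁻¹) fun k =>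
      Matrix.mul_nonsing_inv _ ((Matrix.isUnit_iff_isUnit_det _).1 (hpos k).isUnit))
  exact ⟨h1, by rw [h2, block_congruence]⟩

lemma withWeights_isStable {L : LDM m} (hL : L.IsStable) (i j : Fin m) (β γ : ℂ) :
    (L.withWeights i j β γ).IsStable := hL

/-! ### Dependence of the `(j, i)` block on the two weights -/

/-- The part of the `(j, i)` block of `Φ_X⁻¹` contributed by the common children of `i` and `j`. -/
noncomputable def commonChildTerm (L : LDM m) (T : ℕ) (e : Fin m → L2Seq P) (i j : Fin m)
    (ω : ℝ) : Matrix (Fin T) (Fin T) ℂ :=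
  ∑ k ∈ (Finset.univ.erase j).erase i,
    (-(L.b k j • transferMatrix (liftImpulse T (L.nodeFilter k)) ω)).conjTranspose *
      (psd (liftSeq T (e k)) ω)⁻¹ * -(L.b k i • transferMatrix (liftImpulse T (L.nodeFilter k)) ω)

/-- The `(j, i)` block of `Φ_X⁻¹` as a function of the two weights between `i` and `j`. -/
noncomputable def weightedBlock (L : LDM m) (T : ℕ) (e : Fin m → L2Seq P) (i j : Fin m)
    (ω : ℝ) (β γ : ℂ) : Matrix (Fin T) (Fin T) ℂ :=
  L.commonChildTerm T e i j ω
    - (starRingEnd ℂ) β • ((transferMatrix (liftImpulse T (L.nodeFilter i)) ω).conjTranspose *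
      (psd (liftSeq T (e i)) ω)⁻¹)
    - γ • ((psd (liftSeq T (e j)) ω)⁻¹ * transferMatrix (liftImpulse T (L.nodeFilter j)) ω)

/-- Because `1 - H` has identity diagonal blocks, `k = j` gives the term linear in `γ` and `k = i`
the term linear in `conj β`. No other `k` sees the altered weights. -/
lemma sum_block_withWeights (L : LDM m) (T : ℕ) (e : Fin m → L2Seq P) {i j : Fin m} (hij : i ≠ j)
    (ω : ℝ) (β γ : ℂ) :
    ∑ k, (block (1 - transferMatrix ((L.withWeights i j β γ).liftedTransfer T) ω) k j).conjTranspose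
      * (psd (liftSeq T (e k)) ω)⁻¹ *
        block (1 - transferMatrix ((L.withWeights i j β γ).liftedTransfer T) ω) k i =
      L.weightedBlock T e i j ω β γ := by
  simp only [block_transferMatrix]
  rw [← Finset.add_sum_erase _ _ (Finset.mem_univ j),
    ← Finset.add_sum_erase _ _ (Finset.mem_erase.2 ⟨hij, Finset.mem_univ i⟩)]
  have h1 : ∀ k, (L.withWeights i j β γ).nodeFilter k = L.nodeFilter k := fun k => rfl
  have h2 : ∀ r s, (L.withWeights i j β γ).b r s =
      if r = i ∧ s = j then β else if r = j ∧ s = i then γ else L.b r s := fun r s => rfl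
  have hrest : ∑ k ∈ (Finset.univ.erase j).erase i,
      ((if k = j then (1 : Matrix (Fin T) (Fin T) ℂ) else -((L.withWeights i j β γ).b k j •
        transferMatrix (liftImpulse T ((L.withWeights i j β γ).nodeFilter k)) ω)).conjTranspose *
        (psd (liftSeq T (e k)) ω)⁻¹ *
        if k = i then (1 : Matrix (Fin T) (Fin T) ℂ) else -((L.withWeights i j β γ).b k i •
          transferMatrix (liftImpulse T ((L.withWeights i j β γ).nodeFilter k)) ω)) =
      L.commonChildTerm T e i j ω := by
    refine Finset.sum_congr rfl fun k hk => ?_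
    have hki : k ≠ i := (Finset.mem_erase.1 hk).1
    have hkj : k ≠ j := (Finset.mem_erase.1 (Finset.mem_erase.1 hk).2).1
    simp [hki, hkj, h1, h2]
  rw [hrest]
  simp [h1, h2, hij, hij.symm, weightedBlock]
  abel

lemma im_det_weightedBlock_eq_zero {L : LDM m} (hL : L.IsStable) {T : ℕ} [NeZero T]
    {per : Fin m → ℕ} {p e : Fin m → L2Seq P} (hinput : L.IsInput per p e) {i j : Fin m}
    (hij : i ≠ j) {β γ : ℂ} (h : (β, γ) ∈ constantPhaseWeights L T e i j) {ω ω' : ℝ}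
    (hω : ω ∈ Set.Ico (0 : ℝ) (2 * Real.pi)) (hω' : ω' ∈ Set.Ico (0 : ℝ) (2 * Real.pi))
    (hpos : ∀ k, (psd (liftSeq T (e k)) ω).PosDef)
    (hpos' : ∀ k, (psd (liftSeq T (e k)) ω').PosDef) :
    ((L.weightedBlock T e i j ω β γ).det *
      (starRingEnd ℂ) (L.weightedBlock T e i j ω' β γ).det).im = 0 := by
  obtain ⟨x, hx, hph⟩ := h
  have key : ∀ ω : ℝ, (∀ k, (psd (liftSeq T (e k)) ω).PosDef) → _ := fun ω hp =>
    hx.inv_psd (withWeights_isStable hL i j β γ) (hinput.psd_liftFamily T ω) hp j i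
  obtain ⟨h1, h2⟩ := key ω hpos
  obtain ⟨h1', h2'⟩ := key ω' hpos'
  have := hph.im_det_mul_conj_eq_zero ⟨hω, h1⟩ ⟨hω', h1'⟩
  simp only [h2, h2'] at this
  rwa [L.sum_block_withWeights T e hij, L.sum_block_withWeights T e hij] at this

end LDM

end

/-! ### Null sets of weights -/

lemma im_mul_pos_mul_conj_ne_zero {u v d d' : ℂ} (hu : 0 < u) (hv : 0 < v)
    (h : (d * (starRingEnd ℂ) d').im ≠ 0) : ((u * d) * (starRingEnd ℂ) (v * d')).im ≠ 0 := by
  obtain ⟨a, ha, rfl⟩ : ∃ a : ℝ, 0 < a ∧ (a : ℂ) = u :=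
    ⟨u.re, (Complex.pos_iff.1 hu).1, Complex.ext rfl (Complex.pos_iff.1 hu).2⟩
  obtain ⟨b, hb, rfl⟩ : ∃ b : ℝ, 0 < b ∧ (b : ℂ) = v :=
    ⟨v.re, (Complex.pos_iff.1 hv).1, Complex.ext rfl (Complex.pos_iff.1 hv).2⟩
  have : (a * d) * (starRingEnd ℂ) (b * d') = ((a * b : ℝ) : ℂ) * (d * (starRingEnd ℂ) d') := by
    simp only [map_mul, Complex.conj_ofReal]
    push_cast
    ring
  rw [this, Complex.im_ofReal_mul]
  exact mul_ne_zero (mul_pos ha hb).ne' h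

theorem mainTheorem3 {Ω : Type*} [MeasurableSpace Ω] (P : Measure Ω) [IsProbabilityMeasure P]
    {m : ℕ} (L : LDM m) (hstable : L.IsStable) (hone : L.AtMostOneCommonChild)
    (per : Fin m → ℕ) (T : ℕ) (hT : T = Finset.univ.lcm per)
    (p e : Fin m → L2Seq P) (hinput : L.IsInput per p e)
    (hdetect : TopologicallyDetectable T e)
    (i j : Fin m) (hij : L.topology.Adj j i) :
    volume (constantPhaseWeights L T e i j) = 0 ∧
    (L.b j i = 0 → volume {β : ℂ | (β, 0) ∈ constantPhaseWeights L T e i j} = 0) ∧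
    (L.b i j = 0 → volume {γ : ℂ | (0, γ) ∈ constantPhaseWeights L T e i j} = 0) := by
  have : NeZero T := ⟨by rw [hT]; exact hinput.period_pos.ne'⟩
  have hne : i ≠ j := hij.ne'
  have hae : ∀ᵐ ω ∂(volume.restrict (Set.Ico (0 : ℝ) (2 * Real.pi))),
      ∀ k, (psd (liftSeq T (e k)) ω).PosDef := ae_all_iff.2 fun k => (hdetect k).2
  have hphase := fun k => by
    obtain ⟨h1, h2, h3, h4⟩ := LDM.nodeFilter_props hstable k
    exact exists_det_lift_phase_ne (T := T) h1 h2 h3 h4 hae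
  have hβ : ∀ γ : ℂ, volume {β : ℂ | (β, γ) ∈ constantPhaseWeights L T e i j} = 0 := by
    intro γ
    obtain ⟨ω, ω', hp, hp', hω, hω', him⟩ := hphase i
    refine measure_mono_null (fun β hβ => ?_) (volume_im_det_mul_conj_eq_zero'
      ((transferMatrix (liftImpulse T (L.nodeFilter i)) ω).conjTranspose *
        (psd (liftSeq T (e i)) ω)⁻¹)
      (L.commonChildTerm T e i j ω - γ • ((psd (liftSeq T (e j)) ω)⁻¹ *
        transferMatrix (liftImpulse T (L.nodeFilter j)) ω))
      ((transferMatrix (liftImpulse T (L.nodeFilter i)) ω').conjTranspose *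
        (psd (liftSeq T (e i)) ω')⁻¹)
      (L.commonChildTerm T e i j ω' - γ • ((psd (liftSeq T (e j)) ω')⁻¹ *
        transferMatrix (liftImpulse T (L.nodeFilter j)) ω')) ?_)
    · have := LDM.im_det_weightedBlock_eq_zero hstable hinput hne hβ hω hω' hp hp'
      simp only [LDM.weightedBlock] at this
      rwa [sub_right_comm, sub_right_comm (L.commonChildTerm T e i j ω')] at this
    · simp only [Matrix.det_mul, Matrix.det_conjTranspose, mul_comm _ (Matrix.det (_)⁻¹)]
      -- The determinants of the inverse spectra are positive and can be dropped. What remains is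
      -- conjugated, since the filter of node `i` enters as an adjoint, and this only flips the sign
      -- of the imaginary part.
      refine im_mul_pos_mul_conj_ne_zero (hp i).inv.det_pos (hp' i).inv.det_pos ?_
      intro h
      refine him ?_
      rw [← neg_eq_zero, ← Complex.conj_im, map_mul]
      exact h
  obtain ⟨ω, ω', hp, hp', hω, hω', him⟩ := hphase j
  -- Fubini is applied to this closed superset, cut out by a single pair of frequencies, so
  -- measurability of `constantPhaseWeights` is not required.
  set S : Set (ℂ × ℂ) := {q | ((L.weightedBlock T e i j ω q.1 q.2).det *
    (starRingEnd ℂ) (L.weightedBlock T e i j ω' q.1 q.2).det).im = 0} with hS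
  have hsub : constantPhaseWeights L T e i j ⊆ S := fun q hq =>
    LDM.im_det_weightedBlock_eq_zero hstable hinput hne hq hω hω' hp hp'
  have hγ : ∀ β : ℂ, volume (Prod.mk β ⁻¹' S) = 0 := by
    intro β
    refine volume_im_det_mul_conj_eq_zero
      ((psd (liftSeq T (e j)) ω)⁻¹ * transferMatrix (liftImpulse T (L.nodeFilter j)) ω)
      (L.commonChildTerm T e i j ω - (starRingEnd ℂ) β •
        ((transferMatrix (liftImpulse T (L.nodeFilter i)) ω).conjTranspose *
          (psd (liftSeq T (e i)) ω)⁻¹))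
      ((psd (liftSeq T (e j)) ω')⁻¹ * transferMatrix (liftImpulse T (L.nodeFilter j)) ω')
      (L.commonChildTerm T e i j ω' - (starRingEnd ℂ) β •
        ((transferMatrix (liftImpulse T (L.nodeFilter i)) ω').conjTranspose *
          (psd (liftSeq T (e i)) ω')⁻¹)) ?_
    simp only [Matrix.det_mul]
    exact im_mul_pos_mul_conj_ne_zero (hp j).inv.det_pos (hp' j).inv.det_pos him
  have hmeas : MeasurableSet S := by
    refine (isClosed_eq ?_ continuous_const).measurableSet
    unfold LDM.weightedBlock
    fun_prop
  refine ⟨measure_mono_null hsub ?_, fun _ => hβ 0,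
    fun _ => measure_mono_null (fun γ h => hsub h) (hγ 0)⟩
  rw [Measure.volume_eq_prod, Measure.measure_prod_null hmeas]
  exact Filter.Eventually.of_forall hγ
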